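/- Let $G$ be a locally compact (Hausdorff) group with Borel $\sigma$-algebra and right Haar measure $\mu$. A length function on $G$ is a Borel function $l:G\to[0,\infty)$ with $l(e)=0$, $l(g^{-1})=l(g)$ and $l(gh)\le l(g)+l(h)$ for all $g,h\in G$; it is locally bounded if it is bounded on every compact subset of $G$. For $f\in C_c(G)$ let $\|\lambda(f)\|$ be the norm of the operator $\xi\mapsto f*\xi$ on $L^2(G,\mu)$, where $(f*\xi)(x)=\int_G f(xy^{-1})\xi(y)\,d\mu(y)$. The group $G$ has property (RD) if there exist a locally bounded length function $l$ on $G$ and real numbers $s,c>0$ such that $$\|\lambda(f)\|\le c\left(\int_G |f(x)|^2(1+l(x))^{2s}\,d\mu(x)\right)^{1/2}\qquad\text{for all } f\in C_c(G).$$ (This does not depend on the normalization of $\mu$.) Let $K$ be a compact normal subgroup of a locally compact group $G$. Then $G$ has property (RD) if and only if the quotient group $G/K$ has property (RD). -/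

import Mathlib

open MeasureTheory
open scoped ENNReal NNReal

namespace RapidDecay

/-- A length function on a topological group `G`: a Borel function `l : G → [0, ∞)` with `l(e) = 0`,
`l(g⁻¹) = l(g)` and `l(gh) ≤ l(g) + l(h)`. -/
structure IsLengthFunction {G : Type*} [Group G] [TopologicalSpace G] (l : G → ℝ≥0) : Prop where
  borel_measurable : Measurable[borel G] l
  map_one : l 1 = 0
  map_inv : ∀ g : G, l g⁻¹ = l g
  map_mul_le : ∀ g h : G, l (g * h) ≤ l g + l h

/-- A function is locally bounded if it is bounded on every compact set. -/
def LocallyBounded {G : Type*} [TopologicalSpace G] (l : G → ℝ≥0) : Prop :=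
  ∀ C : Set G, IsCompact C → BddAbove (l '' C)

section Norms

variable {G : Type*} [Group G] [MeasurableSpace G]

/-- The convolution `(f * ξ)(x) = ∫ f(x y⁻¹) ξ(y) dμ(y)`, for a right Haar measure `μ`. -/
noncomputable def conv (μ : Measure G) (f ξ : G → ℂ) (x : G) : ℂ :=
  ∫ y, f (x * y⁻¹) * ξ y ∂μ

/-- The convolution norm `‖λ(f)‖`: the operator norm of `ξ ↦ f * ξ` on `L²(G, μ)`,
with values in `[0, ∞]`. -/
noncomputable def convNorm (μ : Measure G) (f : G → ℂ) : ℝ≥0∞ :=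
  ⨆ (ξ : G → ℂ) (_ : MemLp ξ 2 μ) (_ : eLpNorm ξ 2 μ ≤ 1), eLpNorm (conv μ f ξ) 2 μ

/-- The weighted `L²`-norm `‖f‖_{s,l} = (∫ |f(x)|² (1 + l(x))^{2s} dμ(x))^{1/2}`. -/
noncomputable def weightedNorm (μ : Measure G) (l : G → ℝ≥0) (s : ℝ) (f : G → ℂ) : ℝ≥0∞ :=
  (∫⁻ x, ‖f x‖ₑ ^ 2 * (((1 + l x) ^ (2 * s) : ℝ≥0) : ℝ≥0∞) ∂μ) ^ (1 / 2 : ℝ)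

end Norms

/-- A right Haar measure on a locally compact group: the image under inversion of the left
Haar measure. -/
noncomputable def rightHaar (G : Type*) [Group G] [TopologicalSpace G] [IsTopologicalGroup G]
    [LocallyCompactSpace G] [MeasurableSpace G] [BorelSpace G] : Measure G :=
  (Measure.haar : Measure G).inv

/-- Property (RD) for a locally compact group `G` (with its Borel `σ`-algebra): there are a locally
bounded length function `l` and `s, c > 0` such that `‖λ(f)‖ ≤ c ‖f‖_{s,l}` for all `f ∈ C_c(G)`.
A rescaling of the right Haar measure only changes the constant `c`. -/
def HasRD (G : Type*) [Group G] [TopologicalSpace G] [IsTopologicalGroup G]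
    [LocallyCompactSpace G] : Prop :=
  letI : MeasurableSpace G := borel G
  haveI : BorelSpace G := ⟨rfl⟩
  ∃ l : G → ℝ≥0, IsLengthFunction l ∧ LocallyBounded l ∧
    ∃ s c : ℝ, 0 < s ∧ 0 < c ∧
      ∀ f : G → ℂ, Continuous f → HasCompactSupport f →
        convNorm (rightHaar G) f ≤ ENNReal.ofReal c * weightedNorm (rightHaar G) l s f

end RapidDecay

/-! Let `π : G → Q` be the quotient map with compact kernel `K`. It is proper, so the push-forward
of Haar measure is regular and, by uniqueness, a multiple of Haar measure on `Q`. Rescaling the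
measure only changes the constant in (RD), so both directions compare `μ` with `μ.map π`.

From `G` to `Q`: composition with `π` embeds `L²(Q)` isometrically into `L²(G)` and intertwines
convolution by `f` with convolution by `f ∘ π`; hence `‖λ(f)‖ ≤ ‖λ(f ∘ π)‖` (`convNorm_map_le`). A
length function on `G` descends with a bounded error (`exists_isLengthFunction_quotient`), which
costs only a constant in the weighted norm.

From `Q` to `G`: take the length function `l ∘ π`. Replace `f` and `ξ` by their `L²`-norms `F` and
`X` on the cosets of `K`. Averaging the convolution integral over cosets and applying Cauchy–Schwarz
on each gives `|f * ξ| ≤ (F * X) ∘ π` (`enorm_conv_le_enorm_conv_fiberNorm`). Passing to `F` and `X`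
preserves both the `L²`-norm and the weighted norm, since the weight is constant on cosets
(`lintegral_enorm_fiberNorm`). As Haar measure need not be σ-finite, Fubini is used only on `C_c`,
and density of `C_c` in `L²` does the rest. -/

open Set Filter Topology Pointwise

namespace RapidDecay

/-! ### Length functions on a group and on its quotient -/

section LengthFunctions

variable {H : Type*} [Group H] [TopologicalSpace H] [IsTopologicalGroup H]

/-- An increasing multiplicative filtration of a topological group by symmetric sets gives a Borel
length function, whose closed balls are the closures of the sets of the filtration. -/
theorem exists_isLengthFunction_of_filtration (A : ℕ → Set H) (hmono : Monotone A)
    (h1 : 1 ∈ A 0) (hinv : ∀ n, ∀ g ∈ A n, g⁻¹ ∈ A n)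
    (hmul : ∀ m n, ∀ g ∈ A m, ∀ h ∈ A n, g * h ∈ A (m + n)) (hex : ∀ g, ∃ n, g ∈ A n) :
    ∃ l : H → ℕ, IsLengthFunction (fun g => (l g : ℝ≥0)) ∧
      ∀ g n, l g ≤ n ↔ g ∈ closure (A n) := by
  classical
  have hex' : ∀ g, ∃ n, g ∈ closure (A n) := fun g => (hex g).imp fun n h => subset_closure h
  -- Closures make the balls closed, so that `l` is Borel even if the sets `A n` are not, as may
  -- happen for images of Borel sets.
  let l : H → ℕ := fun g => Nat.find (hex' g)
  have hl : ∀ g n, l g ≤ n ↔ g ∈ closure (A n) := fun g n =>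
    ⟨fun h => closure_mono (hmono h) (Nat.find_spec (hex' g)), fun h => Nat.find_min' _ h⟩
  have hinv' : ∀ g, l g⁻¹ ≤ l g := fun g => (hl _ _).2 <|
    map_mem_closure continuous_inv ((hl g _).1 le_rfl) (hinv _)
  refine ⟨l, ⟨?_, ?_, fun g => ?_, fun g h => ?_⟩, hl⟩
  · have : Measurable[borel H] l := by
      let _ : MeasurableSpace H := borel H
      have : BorelSpace H := ⟨rfl⟩
      refine measurable_of_Iic fun n => ?_
      have : l ⁻¹' Iic n = closure (A n) := by ext g; exact hl g n
      rw [this]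
      exact isClosed_closure.measurableSet
    exact (measurable_from_nat (f := fun n : ℕ => (n : ℝ≥0))).comp this
  · have : l 1 ≤ 0 := (hl _ _).2 (subset_closure h1)
    simpa using this
  · have h2 := hinv' g⁻¹
    rw [inv_inv] at h2
    exact_mod_cast le_antisymm (hinv' g) h2
  · have : l (g * h) ≤ l g + l h := (hl _ _).2 <|
      map_mem_closure₂ continuous_mul ((hl g _).1 le_rfl) ((hl h _).1 le_rfl) (hmul _ _)
    exact_mod_cast this

end LengthFunctions

section Quotient

variable {G Q : Type*} [Group G] [TopologicalSpace G] [IsTopologicalGroup G]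
  [Group Q] [TopologicalSpace Q] {π : G →* Q}

/-- The saturation of a closed set `C` is `C * ker π`, a closed set times a compact one. -/
theorem isClosedMap_of_isCompact_ker (hπ : IsOpenQuotientMap π)
    (hK : IsCompact (π.ker : Set G)) : IsClosedMap π := by
  intro C hC
  rw [← hπ.isQuotientMap.isClosed_preimage]
  have : π ⁻¹' (π '' C) = C * (π.ker : Set G) := by
    ext g
    simp only [mem_preimage, mem_image, Set.mem_mul, SetLike.mem_coe, MonoidHom.mem_ker]
    constructor
    · rintro ⟨c, hc, h⟩
      exact ⟨c, hc, c⁻¹ * g, by simp [h], by simp⟩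
    · rintro ⟨c, hc, k, hk, rfl⟩
      exact ⟨c, hc, by simp [hk]⟩
  rw [this]
  exact hC.mul_right_of_isCompact hK

theorem isProperMap_of_isCompact_ker (hπ : IsOpenQuotientMap π)
    (hK : IsCompact (π.ker : Set G)) : IsProperMap π := by
  refine isProperMap_iff_isClosedMap_and_compact_fibers.2
    ⟨hπ.continuous, isClosedMap_of_isCompact_ker hπ hK, fun q => ?_⟩
  obtain ⟨g, rfl⟩ := hπ.surjective q
  have : π ⁻¹' {π g} = (g * ·) '' (π.ker : Set G) := by
    ext h
    simp only [mem_preimage, mem_singleton_iff, mem_image, SetLike.mem_coe, MonoidHom.mem_ker]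
    constructor
    · intro h'
      exact ⟨g⁻¹ * h, by simp [h'], by simp⟩
    · rintro ⟨k, hk, rfl⟩
      simp [hk]
  rw [this]
  exact hK.image (continuous_const_mul g)

/-- A locally bounded length function descends, up to a bounded error, to a locally bounded length
function on the quotient by a compact normal subgroup. -/
theorem exists_isLengthFunction_quotient [IsTopologicalGroup Q] [LocallyCompactSpace G] (hπ : IsOpenQuotientMap π)
    (hK : IsCompact (π.ker : Set G)) {l : G → ℝ≥0} (hl : IsLengthFunction l)
    (hb : LocallyBounded l) :
    ∃ l' : Q → ℝ≥0, IsLengthFunction l' ∧ LocallyBounded l' ∧ ∃ M : ℝ≥0, ∀ g, l g ≤ l' (π g) + M := by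
  obtain ⟨l', hl', hle⟩ := exists_isLengthFunction_of_filtration
    (fun n : ℕ => π '' {g | l g ≤ n})
    (fun m n h => image_mono <| ofPred_subset_ofPred.2 fun g hg =>
      hg.trans (by exact_mod_cast h))
    ⟨1, by simp [hl.map_one], map_one π⟩
    (by
      rintro n _ ⟨g, hg, rfl⟩
      exact ⟨g⁻¹, by simpa [hl.map_inv] using hg, map_inv π g⟩)
    (by
      rintro m n _ ⟨g, hg, rfl⟩ _ ⟨h, hh, rfl⟩
      refine ⟨g * h, ?_, map_mul π g h⟩
      rw [mem_ofPred_eq] at *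
      push_cast
      exact (hl.map_mul_le g h).trans (add_le_add hg hh))
    (fun q => by
      obtain ⟨g, rfl⟩ := hπ.surjective q
      exact ⟨⌈l g⌉₊, g, by simpa using Nat.le_ceil (l g), rfl⟩)
  refine ⟨_, hl', fun C hC => ?_, ?_⟩
  · obtain ⟨B, hB⟩ := hb _ ((isProperMap_of_isCompact_ker hπ hK).isCompact_preimage hC)
    refine ⟨(⌈B⌉₊ : ℝ≥0), ?_⟩
    rintro _ ⟨q, hq, rfl⟩
    obtain ⟨g, rfl⟩ := hπ.surjective q
    have : l' (π g) ≤ ⌈B⌉₊ := (hle _ _).2 (subset_closure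
      ⟨g, (hB (mem_image_of_mem l hq)).trans (Nat.le_ceil _), rfl⟩)
    exact Nat.cast_le.2 this
  · obtain ⟨V, hV, hV1⟩ := exists_compact_mem_nhds (1 : G)
    obtain ⟨B, hB⟩ := hb V hV
    obtain ⟨B', hB'⟩ := hb _ hK
    refine ⟨B + B', fun g => ?_⟩
    have hg := (hle (π g) _).1 le_rfl
    -- `π g` is only in the closure of the image of a ball. This neighbourhood meets that image in
    -- some `π h`, and then `h⁻¹ * g` lies in `V * ker π`, on which `l` is at most `B + B'`.
    have hW : {q : Q | q⁻¹ * π g ∈ π '' V} ∈ 𝓝 (π g) := by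
      have hc : Continuous fun q : Q => q⁻¹ * π g := by fun_prop
      refine hc.continuousAt.preimage_mem_nhds ?_
      have := hπ.isOpenMap.image_mem_nhds hV1
      rwa [map_one, ← inv_mul_cancel (π g)] at this
    obtain ⟨_, ⟨v, hv, hvh⟩, h, hh, rfl⟩ := mem_closure_iff_nhds.1 hg _ hW
    have hk : v⁻¹ * (h⁻¹ * g) ∈ (π.ker : Set G) := by
      simp [MonoidHom.mem_ker, hvh]
    calc l g = l (h * (v * (v⁻¹ * (h⁻¹ * g)))) := by simp
      _ ≤ l h + (l v + l (v⁻¹ * (h⁻¹ * g))) :=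
        (hl.map_mul_le _ _).trans (add_le_add le_rfl (hl.map_mul_le _ _))
      _ ≤ l' (π g) + (B + B') :=
        add_le_add hh (add_le_add (hB (mem_image_of_mem l hv)) (hB' (mem_image_of_mem l hk)))

end Quotient

section Composition

variable {G Q : Type*} [Group G] [TopologicalSpace G] [Group Q] [TopologicalSpace Q] {π : G →* Q}

theorem IsLengthFunction.comp {l : Q → ℝ≥0} (hl : IsLengthFunction l) (hπ : Continuous π) :
    IsLengthFunction (l ∘ π) where
  borel_measurable := hl.borel_measurable.comp hπ.borel_measurable
  map_one := by simp [hl.map_one]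
  map_inv g := by simp [hl.map_inv]
  map_mul_le g h := by simpa using hl.map_mul_le (π g) (π h)

theorem LocallyBounded.comp {l : Q → ℝ≥0} (hl : LocallyBounded l) (hπ : Continuous π) :
    LocallyBounded (l ∘ π) := fun C hC => by
  rw [image_comp]
  exact hl _ (hC.image hπ)

end Composition

/-! ### Push-forward of Haar measure under a proper homomorphism -/

section PushForward

variable {X Y : Type*} [TopologicalSpace X] [TopologicalSpace Y] [MeasurableSpace X]
  [BorelSpace X] [MeasurableSpace Y] [BorelSpace Y]

/-- The push-forward of a regular measure under a proper map is regular. -/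
theorem regular_map_of_isProperMap {f : X → Y} (hf : IsProperMap f) [R1Space Y] (μ : Measure X)
    [μ.Regular] : (μ.map f).Regular := by
  have hm : Measurable f := hf.continuous.measurable
  have hfin : IsFiniteMeasureOnCompacts (μ.map f) := ⟨fun {C} hC => by
    rw [← hC.measure_closure, Measure.map_apply hm isClosed_closure.measurableSet]
    exact (hf.isCompact_preimage hC.closure).measure_lt_top⟩
  have hout : (μ.map f).OuterRegular := ⟨fun {A} hA r hr => by
    rw [Measure.map_apply hm hA] at hr
    obtain ⟨U, hU, hUo, hUr⟩ := (f ⁻¹' A).exists_isOpen_lt_of_lt r hr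
    have hV : IsOpen (f '' Uᶜ)ᶜ := (hf.isClosedMap _ hUo.isClosed_compl).isOpen_compl
    -- This is the largest set whose preimage lies in `U`; it is open because `f` is closed.
    refine ⟨(f '' Uᶜ)ᶜ, ?_, hV, ?_⟩
    · rintro a ha ⟨x, hx, rfl⟩
      exact hx (hU ha)
    · rw [Measure.map_apply hm hV.measurableSet]
      refine (measure_mono fun x hx => ?_).trans_lt hUr
      by_contra h
      exact hx ⟨x, h, rfl⟩⟩
  refine { toIsFiniteMeasureOnCompacts := hfin, toOuterRegular := hout, innerRegular := ?_ }
  intro U hU r hr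
  rw [Measure.map_apply hm hU.measurableSet] at hr
  obtain ⟨C, hCU, hC, hCr⟩ := (hU.preimage hf.continuous).exists_lt_isCompact hr
  refine ⟨f '' C, image_subset_iff.2 hCU, hC.image hf.continuous, hCr.trans_le ?_⟩
  exact (measure_mono (subset_preimage_image f C)).trans (Measure.le_map_apply hm.aemeasurable _)

end PushForward

section Haar

variable {G Q : Type*} [Group G] [TopologicalSpace G] [IsTopologicalGroup G]
  [LocallyCompactSpace G] [MeasurableSpace G] [BorelSpace G]
  [Group Q] [TopologicalSpace Q] [IsTopologicalGroup Q] [LocallyCompactSpace Q]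
  [MeasurableSpace Q] [BorelSpace Q] {π : G →* Q}

instance : (rightHaar G).Regular := inferInstanceAs (Measure.inv _).Regular

instance : (rightHaar G).IsMulRightInvariant :=
  inferInstanceAs (Measure.inv _).IsMulRightInvariant

/-- The push-forward of left Haar measure is a regular Haar measure, hence a positive multiple of
the given one. Since `π` commutes with inversion, the same holds for right Haar measure. -/
theorem exists_map_rightHaar_eq_smul (hπ : IsOpenQuotientMap π)
    (hK : IsCompact (π.ker : Set G)) :
    ∃ a : ℝ≥0∞, a ≠ 0 ∧ a ≠ ∞ ∧ (rightHaar G).map π = a • rightHaar Q := by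
  have hp := isProperMap_of_isCompact_ker hπ hK
  have := Measure.isHaarMeasure_map (Measure.haar : Measure G) π hπ.continuous hπ.surjective
    (hasBasis_cocompact.tendsto_right_iff.2 fun C hC => (hp.isCompact_preimage hC).compl_mem_cocompact)
  have := regular_map_of_isProperMap hp (Measure.haar : Measure G)
  have h := Measure.isMulLeftInvariant_eq_smul_of_regular
    ((Measure.haar : Measure G).map π) (Measure.haar : Measure Q)
  have hpos := Measure.haarScalarFactor_pos_of_isHaarMeasure
    ((Measure.haar : Measure G).map π) (Measure.haar : Measure Q)
  generalize Measure.haarScalarFactor ((Measure.haar : Measure G).map π)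
    (Measure.haar : Measure Q) = a at h hpos
  refine ⟨a, by exact_mod_cast hpos.ne', ENNReal.coe_ne_top, ?_⟩
  have hcomp : π ∘ Inv.inv = Inv.inv ∘ π := by ext g; simp
  have hm : Measurable π := hπ.continuous.measurable
  rw [rightHaar, Measure.inv_def, Measure.map_map hm measurable_inv, hcomp,
      ← Measure.map_map measurable_inv hm, h, Measure.map_smul, rightHaar, Measure.inv_def]
  rfl

end Haar

/-! ### Density of `C_c` in `L²` and the convolution norm -/

section Density

variable {X E : Type*} [TopologicalSpace X] [RegularSpace X] [LocallyCompactSpace X]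
  [MeasurableSpace X] [BorelSpace X] [NormedAddCommGroup E] [NormedSpace ℝ E]
  {μ : Measure X} [μ.Regular] {p : ℝ≥0∞}

/-- A version of `MeasureTheory.MemLp.exists_hasCompactSupport_eLpNorm_sub_le` for spaces that need
not be normal. -/
theorem exists_hasCompactSupport_eLpNorm_sub_le_of_regularSpace (hp : p ≠ ∞) {f : X → E}
    (hf : MemLp f p μ) {ε : ℝ≥0∞} (hε : ε ≠ 0) :
    ∃ g : X → E, HasCompactSupport g ∧ eLpNorm (f - g) p μ ≤ ε ∧ Continuous g ∧ MemLp g p μ := by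
  suffices H : ∃ g : X → E, eLpNorm (f - g) p μ ≤ ε ∧ HasCompactSupport g ∧ Continuous g by
    obtain ⟨g, hg, hgc, hgcont⟩ := H
    exact ⟨g, hgc, hg, hgcont, hgcont.memLp_of_hasCompactSupport hgc⟩
  refine hf.induction_dense hp _ ?_ ?_ ?_ hε
  · intro c t ht htμ ε hε
    obtain ⟨δ, δpos, hδ⟩ := exists_Lp_half E μ p hε
    obtain ⟨η, ηpos, hη⟩ : ∃ η : ℝ≥0, 0 < η ∧
        ∀ s : Set X, μ s ≤ η → eLpNorm (s.indicator fun _x => c) p μ ≤ δ :=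
      exists_eLpNorm_indicator_le hp c δpos.ne'
    have hη0 : (η : ℝ≥0∞) ≠ 0 := ENNReal.coe_ne_zero.2 ηpos.ne'
    obtain ⟨s, hst, hs, hsc, hsμ⟩ := ht.exists_isCompact_isClosed_sdiff_lt htμ.ne hη0
    obtain ⟨U, hsU, hU, -, hUμ⟩ :=
      hsc.measurableSet.exists_isOpen_sdiff_lt (hs.measure_ne_top (μ := μ)) hη0
    obtain ⟨φ, hφ1, hφ0, hφc, hφ⟩ := exists_continuous_one_zero_of_isCompact hs hU.isClosed_compl
      (disjoint_compl_right_iff_subset.2 hsU)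
    have hcont : Continuous fun x => φ x • c := by fun_prop
    refine ⟨fun x => φ x • c, ?_, hφc.smul_right, hcont⟩
    -- The difference is supported in `U \ s`, a set of measure less than `η`, and is bounded there
    -- by `‖c‖`.
    have h1 : eLpNorm ((fun x => φ x • c) - s.indicator fun _ => c) p μ ≤ δ := by
      refine (eLpNorm_mono fun x => ?_).trans (hη _ hUμ.le)
      by_cases hxs : x ∈ s
      · simp [hxs, hφ1 hxs]
      · by_cases hxU : x ∈ U
        · simpa [hxs, hxU, norm_smul, abs_of_nonneg (hφ x).1] using
            mul_le_of_le_one_left (norm_nonneg c) (hφ x).2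
        · simp [hxs, hxU, hφ0 (show x ∈ Uᶜ from hxU)]
    have h2 : eLpNorm ((s.indicator fun _ => c) - t.indicator fun _ => c) p μ ≤ δ := by
      rw [← eLpNorm_neg, neg_sub, ← indicator_sdiff hst]
      exact hη _ hsμ.le
    have hsm := (aestronglyMeasurable_const (b := c) (μ := μ)).indicator hsc.measurableSet
    have htm := (aestronglyMeasurable_const (b := c) (μ := μ)).indicator ht
    have := hδ _ _ ((hcont.memLp_of_hasCompactSupport (p := p) hφc.smul_right).1.sub hsm) (hsm.sub htm) h1 h2
    rw [sub_add_sub_cancel] at this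
    exact this.le
  · rintro f g ⟨hfc, hf⟩ ⟨hgc, hg⟩
    exact ⟨hfc.add hgc, hf.add hg⟩
  · rintro f ⟨hfc, hf⟩
    exact (hf.memLp_of_hasCompactSupport (p := p) hfc).1

end Density

section WeightedNorm

theorem weightedNorm_smul_measure {G : Type*} [MeasurableSpace G] {μ : Measure G} (l : G → ℝ≥0) (s : ℝ) (f : G → ℂ) (a : ℝ≥0∞) :
    weightedNorm (a • μ) l s f = a ^ (1 / 2 : ℝ) * weightedNorm μ l s f := by
  rw [weightedNorm, lintegral_smul_measure, smul_eq_mul,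
    ENNReal.mul_rpow_of_nonneg _ _ (by norm_num), weightedNorm]

end WeightedNorm

section Convolution

variable {G : Type*} [Group G] [MeasurableSpace G] {μ : Measure G}

theorem conv_const_smul (f ξ : G → ℂ) (c : ℂ) : conv μ f (c • ξ) = c • conv μ f ξ := by
  ext x
  simp only [conv, Pi.smul_apply, smul_eq_mul, ← integral_const_mul]
  congr 1 with y
  ring

theorem conv_smul_measure (f ξ : G → ℂ) (a : ℝ≥0∞) :
    conv (a • μ) f ξ = (a.toReal : ℂ) • conv μ f ξ := by
  ext x
  simp [conv, integral_smul_measure]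

/-- The operator `ξ ↦ f * ξ` satisfies `‖f * ξ‖₂ ≤ ‖λ(f)‖ ‖ξ‖₂`. -/
theorem eLpNorm_conv_le (f : G → ℂ) {ξ : G → ℂ} (hξ : MemLp ξ 2 μ) :
    eLpNorm (conv μ f ξ) 2 μ ≤ convNorm μ f * eLpNorm ξ 2 μ := by
  by_cases h0 : eLpNorm ξ 2 μ = 0
  · have h := (eLpNorm_eq_zero_iff hξ.1 two_ne_zero).1 h0
    have : conv μ f ξ = 0 := by
      ext x
      refine integral_eq_zero_of_ae ?_
      filter_upwards [h] with y hy
      simp [hy]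
    simp [this]
  · set r : ℝ := (eLpNorm ξ 2 μ).toReal with hr
    have hr0 : 0 < r := ENNReal.toReal_pos h0 hξ.2.ne
    have hre : ‖(r : ℂ)‖ₑ = eLpNorm ξ 2 μ := by
      rw [← ofReal_norm, Complex.norm_real, Real.norm_of_nonneg hr0.le, hr,
        ENNReal.ofReal_toReal hξ.2.ne]
    have hrc : (r : ℂ) ≠ 0 := by exact_mod_cast hr0.ne'
    have hdecomp : ξ = (r : ℂ) • ((r : ℂ)⁻¹ • ξ) := by rw [smul_inv_smul₀ hrc]
    have hle : eLpNorm (conv μ f ((r : ℂ)⁻¹ • ξ)) 2 μ ≤ convNorm μ f := by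
      refine le_iSup₂_of_le _ (hξ.const_smul (r : ℂ)⁻¹) (le_iSup_of_le ?_ le_rfl)
      rw [eLpNorm_const_smul, enorm_inv hrc, hre, ENNReal.inv_mul_cancel h0 hξ.2.ne]
    conv_lhs => rw [hdecomp, conv_const_smul, eLpNorm_const_smul, hre]
    rw [mul_comm]
    gcongr

/-- The factors `a ^ (1/2)` in the norms of input and output cancel; the integral defining `conv`
contributes `a`. -/
theorem convNorm_smul_measure_le (f : G → ℂ) {a : ℝ≥0∞} (ha : a ≠ 0) (ha' : a ≠ ∞) :
    convNorm (a • μ) f ≤ a * convNorm μ f := by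
  refine iSup₂_le fun ξ hξ => iSup_le fun h1 => ?_
  have hξ' : MemLp ξ 2 μ := by
    have := hξ.smul_measure (ENNReal.inv_ne_top.2 ha)
    rwa [smul_smul, ENNReal.inv_mul_cancel ha ha', one_smul] at this
  have hae : ‖(a.toReal : ℂ)‖ₑ = a := by
    rw [← ofReal_norm, Complex.norm_real, Real.norm_of_nonneg ENNReal.toReal_nonneg,
      ENNReal.ofReal_toReal ha']
  rw [eLpNorm_smul_measure_of_ne_zero ha, smul_eq_mul] at h1 ⊢
  rw [conv_smul_measure, eLpNorm_const_smul, hae]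
  calc _ ≤ a ^ (1 / 2 : ℝ≥0∞).toReal * (a * (convNorm μ f * eLpNorm ξ 2 μ)) := by
        gcongr
        exact eLpNorm_conv_le f hξ'
    _ = a * convNorm μ f * (a ^ (1 / 2 : ℝ≥0∞).toReal * eLpNorm ξ 2 μ) := by ring
    _ ≤ a * convNorm μ f * 1 := by gcongr
    _ = _ := mul_one _

end Convolution

section ContinuousConvolution

variable {G : Type*} [Group G] [TopologicalSpace G] [IsTopologicalGroup G]
  {f ξ : G → ℂ}

theorem hasCompactSupport_comp_mul_inv (hfc : HasCompactSupport f) (x : G) :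
    HasCompactSupport fun y => f (x * y⁻¹) :=
  hfc.comp_homeomorph ((Homeomorph.inv G).trans (Homeomorph.mulLeft x))

variable [MeasurableSpace G] [BorelSpace G] {μ : Measure G}

theorem continuous_conv [IsFiniteMeasureOnCompacts μ] (hf : Continuous f) (hξ : Continuous ξ) (hξc : HasCompactSupport ξ) :
    Continuous (conv μ f ξ) := by
  rw [← continuousOn_univ]
  refine continuousOn_integral_of_compact_support hξc ?_ fun x y _ hy => ?_
  · refine Continuous.continuousOn ?_
    simp only [Function.uncurry_def]
    fun_prop
  · simp [image_eq_zero_of_notMem_tsupport hy]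

/-- For `f ∈ C_c(G)` the norm of `λ(f)` can be computed on `C_c(G)`. -/
theorem convNorm_le_of_forall_hasCompactSupport [LocallyCompactSpace G] [μ.Regular]
    (hf : Continuous f) (hfc : HasCompactSupport f) {B : ℝ≥0∞}
    (hB : ∀ ξ : G → ℂ, Continuous ξ → HasCompactSupport ξ →
      eLpNorm (conv μ f ξ) 2 μ ≤ B * eLpNorm ξ 2 μ) :
    convNorm μ f ≤ B := by
  refine iSup₂_le fun ξ hξ => iSup_le fun h1 => ?_
  have hε : ∀ n : ℕ, ((n : ℝ≥0∞) + 1)⁻¹ ≠ 0 := fun n => by simp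
  choose g hgc hgξ hg hgL using fun n =>
    exists_hasCompactSupport_eLpNorm_sub_le_of_regularSpace ENNReal.ofNat_ne_top hξ (hε n)
  have hε0 : Tendsto (fun n : ℕ => ((n : ℝ≥0∞) + 1)⁻¹) atTop (𝓝 0) := by
    have := (tendsto_add_atTop_iff_nat 1).2 ENNReal.tendsto_inv_nat_nhds_zero
    simpa using this
  -- Cauchy–Schwarz against `y ↦ f (x * y⁻¹)`, which is in `C_c`, turns `L²`-convergence of `g n`
  -- into pointwise convergence of the convolutions. Fatou's lemma then passes the bound to `ξ`.
  have hlim : ∀ x, Tendsto (fun n => conv μ f (g n) x) atTop (𝓝 (conv μ f ξ x)) := by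
    intro x
    have hfx : MemLp (fun y => f (x * y⁻¹)) 2 μ :=
      (by fun_prop : Continuous fun y => f (x * y⁻¹)).memLp_of_hasCompactSupport
        (hasCompactSupport_comp_mul_inv hfc x)
    have hint : ∀ {η : G → ℂ}, MemLp η 2 μ → Integrable (fun y => f (x * y⁻¹) * η y) μ :=
      fun hη => hfx.integrable_mul hη
    rw [tendsto_iff_edist_tendsto_0]
    have hup : Tendsto (fun n : ℕ => eLpNorm (fun y => f (x * y⁻¹)) 2 μ * ((n : ℝ≥0∞) + 1)⁻¹) atTop
        (𝓝 0) := by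
      simpa using ENNReal.Tendsto.const_mul hε0 (Or.inr hfx.2.ne)
    refine tendsto_of_tendsto_of_tendsto_of_le_of_le tendsto_const_nhds hup (fun _ => zero_le)
      fun n => ?_
    calc edist (conv μ f (g n) x) (conv μ f ξ x)
        = ‖∫ y, f (x * y⁻¹) * (ξ - g n) y ∂μ‖ₑ := by
          rw [edist_comm, edist_eq_enorm_sub, conv, conv, ← integral_sub (hint hξ) (hint (hgL n))]
          simp [mul_sub]
      _ ≤ ∫⁻ y, ‖f (x * y⁻¹) * (ξ - g n) y‖ₑ ∂μ := enorm_integral_le_lintegral_enorm _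
      _ = eLpNorm ((fun y => f (x * y⁻¹)) • (ξ - g n)) 1 μ := by
          rw [eLpNorm_one_eq_lintegral_enorm]; rfl
      _ ≤ eLpNorm (fun y => f (x * y⁻¹)) 2 μ * eLpNorm (ξ - g n) 2 μ :=
          eLpNorm_smul_le_mul_eLpNorm (hξ.sub (hgL n)).1 hfx.1
      _ ≤ _ := by gcongr; exact hgξ n
  have hBlim : Tendsto (fun n : ℕ => B * (1 + ((n : ℝ≥0∞) + 1)⁻¹)) atTop (𝓝 B) := by
    have h := (tendsto_const_nhds (x := (1 : ℝ≥0∞))).add hε0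
    rw [add_zero] at h
    simpa using ENNReal.Tendsto.const_mul (a := B) h (Or.inl one_ne_zero)
  calc eLpNorm (conv μ f ξ) 2 μ
      ≤ liminf (fun n => eLpNorm (conv μ f (g n)) 2 μ) atTop :=
        Lp.eLpNorm_lim_le_liminf_eLpNorm
          (fun n => (continuous_conv hf (hg n) (hgc n)).aestronglyMeasurable) _ (ae_of_all _ hlim)
    _ ≤ liminf (fun n : ℕ => B * (1 + ((n : ℝ≥0∞) + 1)⁻¹)) atTop := by
        refine liminf_le_liminf (Eventually.of_forall fun n => ?_)
        refine (hB _ (hg n) (hgc n)).trans ?_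
        gcongr
        calc eLpNorm (g n) 2 μ = eLpNorm (ξ - (ξ - g n)) 2 μ := by simp
          _ ≤ eLpNorm ξ 2 μ + eLpNorm (ξ - g n) 2 μ :=
            eLpNorm_sub_le hξ.1 (hξ.sub (hgL n)).1 (by norm_num)
          _ ≤ _ := add_le_add h1 (hgξ n)
    _ = B := hBlim.liminf_eq

end ContinuousConvolution

/-! ### Averages and `L²`-norms over the cosets of a compact subgroup -/

section FiberAverage

variable {G : Type*} [Group G] [TopologicalSpace G] [IsTopologicalGroup G]
  [MeasurableSpace G] [BorelSpace G] {K : Subgroup G} [CompactSpace K]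

/-- The normalized Haar measure of a compact subgroup. -/
noncomputable def probHaar (K : Subgroup G) [CompactSpace K] : Measure K :=
  Measure.haarMeasure ⊤

instance : (probHaar K).IsHaarMeasure := inferInstanceAs (Measure.haarMeasure _).IsHaarMeasure

instance : IsProbabilityMeasure (probHaar K) := ⟨Measure.haarMeasure_self⟩

/-- The average of a function over the left cosets of a compact subgroup. -/
noncomputable def fiberAverage (K : Subgroup G) [CompactSpace K] (h : G → ℝ) (g : G) : ℝ :=
  ∫ k : K, h (g * k) ∂probHaar K

/-- Right translates of the Haar probability measure are again Haar probability measures, so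
uniqueness gives right invariance. Its image under inversion is then also a Haar probability
measure, and uniqueness applies once more. -/
theorem integral_inv_probHaar (u : K → ℝ) : ∫ k, u k⁻¹ ∂probHaar K = ∫ k, u k ∂probHaar K := by
  have hright : (probHaar K).IsMulRightInvariant := ⟨fun k =>
    have : IsProbabilityMeasure ((probHaar K).map (· * k)) :=
      Measure.isProbabilityMeasure_map (by fun_prop)
    Measure.isHaarMeasure_eq_of_isProbabilityMeasure _ _⟩
  have hprob : IsProbabilityMeasure (probHaar K).inv :=
    Measure.isProbabilityMeasure_map measurable_inv.aemeasurable
  have hpos : (probHaar K).inv.IsOpenPosMeasure :=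
    continuous_inv.isOpenPosMeasure_map inv_surjective
  have hhaar : (probHaar K).inv.IsHaarMeasure := ⟨⟩
  have : (probHaar K).IsInvInvariant := ⟨Measure.isHaarMeasure_eq_of_isProbabilityMeasure _ _⟩
  exact integral_inv_eq_self u (probHaar K)

variable {h : G → ℝ}

theorem continuous_fiberAverage (hh : Continuous h) : Continuous (fiberAverage K h) := by
  rw [← continuousOn_univ]
  refine continuousOn_integral_of_compact_support isCompact_univ ?_ fun x y _ hy => ?_
  · refine Continuous.continuousOn ?_
    simp only [Function.uncurry_def]
    fun_prop
  · simp at hy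

theorem fiberAverage_mul_right (h : G → ℝ) (g : G) (k : K) :
    fiberAverage K h (g * k) = fiberAverage K h g := by
  have := integral_mul_left_eq_self (μ := probHaar K) (fun k' : K => h (g * k')) k
  simpa [fiberAverage, mul_assoc] using this

theorem fiberAverage_nonneg (hh : 0 ≤ h) : 0 ≤ fiberAverage K h := fun _ =>
  integral_nonneg fun _ => hh _

/-- Averaging over the cosets of a compact subgroup preserves the integral with respect to
measures invariant under this subgroup. -/
theorem integral_fiberAverage {ρ : Measure G} [IsFiniteMeasureOnCompacts ρ]
    (hρ : ∀ k : K, ρ.map (· * (k : G)) = ρ) (hh : Continuous h) (hhc : HasCompactSupport h) :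
    ∫ g, fiberAverage K h g ∂ρ = ∫ g, h g ∂ρ := by
  have hcont : Continuous (Function.uncurry fun (g : G) (k : K) => h (g * k)) := by
    simp only [Function.uncurry_def]
    fun_prop
  have hsupp : HasCompactSupport (Function.uncurry fun (g : G) (k : K) => h (g * k)) := by
    -- The shear `(g, k) ↦ (g * k, k)` gives the compact support on `G × K` that replaces
    -- σ-finiteness in Fubini.
    let e : G × K ≃ₜ G × K :=
      { toFun := fun p => (p.1 * p.2, p.2)
        invFun := fun p => (p.1 * (p.2 : G)⁻¹, p.2)
        left_inv := fun p => by simp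
        right_inv := fun p => by simp
        continuous_toFun := by fun_prop
        continuous_invFun := by fun_prop }
    have : HasCompactSupport fun p : G × K => h p.1 :=
      HasCompactSupport.intro (hhc.isCompact.prod isCompact_univ) fun p hp =>
        image_eq_zero_of_notMem_tsupport fun h' => hp ⟨h', mem_univ _⟩
    exact this.comp_homeomorph e
  unfold fiberAverage
  rw [integral_integral_swap_of_hasCompactSupport hcont hsupp]
  have : ∀ k : K, ∫ g, h (g * k) ∂ρ = ∫ g, h g ∂ρ := fun k => by
    conv_rhs => rw [← hρ k]
    rw [integral_map (by fun_prop) hh.aestronglyMeasurable]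
  simp [this]

theorem fiberAverage_mul_le {u v : G → ℝ} (hu : Continuous u) (hv : Continuous v) (hu0 : 0 ≤ u)
    (hv0 : 0 ≤ v) (g : G) :
    fiberAverage K (fun x => u x * v x) g ≤
      √(fiberAverage K (fun x => u x ^ 2) g) * √(fiberAverage K (fun x => v x ^ 2) g) := by
  have hmem : ∀ {w : G → ℝ}, Continuous w →
      MemLp (fun k : K => w (g * k)) (ENNReal.ofReal 2) (probHaar K) := fun {w} hw =>
    (by fun_prop : Continuous fun k : K => w (g * k)).memLp_of_hasCompactSupport
      (HasCompactSupport.of_compactSpace _)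
  have := integral_mul_le_Lp_mul_Lq_of_nonneg (μ := probHaar K) Real.HolderConjugate.two_two
    (ae_of_all _ fun k : K => hu0 (g * k)) (ae_of_all _ fun k : K => hv0 (g * k))
    (hmem hu) (hmem hv)
  simpa [fiberAverage, Real.sqrt_eq_rpow] using this

/-- Normality enters here: `x * k⁻¹ * y = x * y * (y⁻¹ * k⁻¹ * y)`, and both inversion and
conjugation by `y⁻¹` preserve the Haar probability measure of `K`. -/
theorem fiberAverage_conj [K.Normal] (hh : Continuous h) (x y : G) :
    ∫ k : K, h (x * (k : G)⁻¹ * y) ∂probHaar K = fiberAverage K h (x * y) := by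
  let φ : K →* K := (MulAut.conjNormal (H := K) y⁻¹).toMonoidHom
  have hφv : ∀ k : K, (φ k : G) = y⁻¹ * k * y := fun k => by
    simp [φ]
  have hφ : MeasurePreserving φ (probHaar K) (probHaar K) := by
    refine MonoidHom.measurePreserving ?_ (MulAut.conjNormal (H := K) y⁻¹).surjective rfl
    refine continuous_induced_rng.2 ?_
    have : (Subtype.val ∘ φ : K → G) = fun k : K => y⁻¹ * (k : G) * y := funext hφv
    rw [this]
    fun_prop
  have hint := integral_map (μ := probHaar K) hφ.measurable.aemeasurable
    (f := fun k : K => h (x * y * k)) 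
    (by fun_prop : Continuous fun k : K => h (x * y * k)).aestronglyMeasurable
  rw [hφ.map_eq] at hint
  rw [fiberAverage, hint, ← integral_inv_probHaar]
  congr 1 with k
  simp [hφv, mul_assoc]

end FiberAverage

section ConvMap

variable {G Q : Type*} [Group G] [TopologicalSpace G] [MeasurableSpace G] [BorelSpace G]
  [Group Q] [TopologicalSpace Q] [IsTopologicalGroup Q] [MeasurableSpace Q] [BorelSpace Q]
  {π : G →* Q} {μ : Measure G}

theorem conv_map_comp (hπ : Continuous π) {F X : Q → ℂ} (hF : Continuous F)
    (hX : AEStronglyMeasurable X (μ.map π)) (x : G) :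
    conv (μ.map π) F X (π x) = conv μ (F ∘ π) (X ∘ π) x := by
  have hc : Continuous fun q => F (π x * q⁻¹) := by fun_prop
  simpa [conv] using integral_map hπ.measurable.aemeasurable (hc.aestronglyMeasurable.mul hX)

end ConvMap

section FiberNorm

variable {G Q : Type*} [Group G] [TopologicalSpace G] [IsTopologicalGroup G]
  [MeasurableSpace G] [BorelSpace G] [Group Q]
  {π : G →* Q} [CompactSpace π.ker] {f ξ : G → ℂ}

/-- The `L²`-norm of a function on the fibers of a homomorphism with compact kernel, as a function
on the quotient. -/
noncomputable def fiberNorm (π : G →* Q) [CompactSpace π.ker] (f : G → ℂ) (q : Q) : ℂ :=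
  (√(fiberAverage π.ker (fun x => ‖f x‖ ^ 2) (Function.invFun π q)) : ℝ)

/-- The preimage chosen by `Function.invFun` is immaterial: two preimages differ by an element of
the kernel, which the average absorbs. -/
theorem fiberNorm_apply (hπ : Function.Surjective π) (f : G → ℂ) (g : G) :
    fiberNorm π f (π g) = (√(fiberAverage π.ker (fun x => ‖f x‖ ^ 2) g) : ℝ) := by
  have hk : g⁻¹ * Function.invFun π (π g) ∈ π.ker := by
    simp [MonoidHom.mem_ker, Function.invFun_eq (hπ (π g))]
  have := fiberAverage_mul_right (K := π.ker) (fun x => ‖f x‖ ^ 2) g ⟨_, hk⟩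
  rw [mul_inv_cancel_left] at this
  rw [fiberNorm, this]

variable [TopologicalSpace Q]

theorem continuous_fiberNorm (hπ : IsOpenQuotientMap π) (hf : Continuous f) :
    Continuous (fiberNorm π f) := by
  rw [hπ.isQuotientMap.continuous_iff]
  have : fiberNorm π f ∘ π = fun g => ((√(fiberAverage π.ker (fun x => ‖f x‖ ^ 2) g) : ℝ) : ℂ) :=
    funext (fiberNorm_apply hπ.surjective f)
  rw [this]
  have := continuous_fiberAverage (K := π.ker) (h := fun x => ‖f x‖ ^ 2) (by fun_prop)
  fun_prop

theorem hasCompactSupport_fiberNorm [R1Space Q] (hπ : IsOpenQuotientMap π)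
    (hfc : HasCompactSupport f) : HasCompactSupport (fiberNorm π f) := by
  refine HasCompactSupport.intro (hfc.isCompact.image hπ.continuous) fun q hq => ?_
  obtain ⟨g, rfl⟩ := hπ.surjective q
  have : ∀ k : π.ker, f (g * k) = 0 := fun k => image_eq_zero_of_notMem_tsupport fun h' =>
    hq ⟨_, h', by simp [MonoidHom.mem_ker.1 k.2]⟩
  simp [fiberNorm_apply hπ.surjective, fiberAverage, this]

/-- The squared fiber norm is the coset average of `‖f‖ ^ 2`, and averaging preserves integrals. The
measure `ρ` is general because both Haar measure and its weighted version are needed. -/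
theorem lintegral_enorm_fiberNorm {ρ : Measure G} [IsFiniteMeasureOnCompacts ρ]
    (hρ : ∀ k : π.ker, ρ.map (· * (k : G)) = ρ) (hπ : IsOpenQuotientMap π) (hf : Continuous f)
    (hfc : HasCompactSupport f) :
    ∫⁻ g, ‖fiberNorm π f (π g)‖ₑ ^ 2 ∂ρ = ∫⁻ g, ‖f g‖ₑ ^ 2 ∂ρ := by
  have hK : IsCompact (π.ker : Set G) := isCompact_iff_compactSpace.2 ‹_›
  set h : G → ℝ := fun x => ‖f x‖ ^ 2 with hh
  have hcont : Continuous h := by fun_prop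
  have hsupp : HasCompactSupport h := hfc.norm.comp_left (g := fun t : ℝ => t ^ 2) (by simp)
  have h0 : 0 ≤ h := fun x => by positivity
  have hA0 := fiberAverage_nonneg (K := π.ker) h0
  have hAc : Continuous (fiberAverage π.ker h) := continuous_fiberAverage hcont
  have hAs : HasCompactSupport (fiberAverage π.ker h) := by
    refine HasCompactSupport.intro (hfc.isCompact.mul hK) fun g hg => ?_
    have : ∀ k : π.ker, f (g * k) = 0 := fun k => image_eq_zero_of_notMem_tsupport fun h' =>
      hg ⟨_, h', (k : G)⁻¹, inv_mem k.2, by simp⟩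
    simp [fiberAverage, hh, this]
  have h1 : ∀ g, ‖fiberNorm π f (π g)‖ₑ ^ 2 = ENNReal.ofReal (fiberAverage π.ker h g) := fun g => by
    rw [fiberNorm_apply hπ.surjective, ← ofReal_norm, Complex.norm_real,
      Real.norm_of_nonneg (Real.sqrt_nonneg _), ← ENNReal.ofReal_pow (Real.sqrt_nonneg _),
      Real.sq_sqrt (hA0 g)]
  have h2 : ∀ g, ‖f g‖ₑ ^ 2 = ENNReal.ofReal (h g) := fun g => by
    rw [← ofReal_norm, ← ENNReal.ofReal_pow (norm_nonneg _)]
  simp only [h1, h2]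
  rw [← ofReal_integral_eq_lintegral_ofReal (hAc.integrable_of_hasCompactSupport hAs)
    (ae_of_all _ hA0), ← ofReal_integral_eq_lintegral_ofReal
    (hcont.integrable_of_hasCompactSupport hsupp) (ae_of_all _ h0),
    integral_fiberAverage hρ hcont hsupp]

variable [IsTopologicalGroup Q] [MeasurableSpace Q] [BorelSpace Q] {μ : Measure G}

/-- The integrand `‖f (x * y⁻¹)‖ * ‖ξ y‖` may be averaged over each coset of the kernel without
changing its integral. Cauchy–Schwarz on the coset then bounds it by the product of fiber norms. -/
theorem enorm_conv_le_enorm_conv_fiberNorm [IsFiniteMeasureOnCompacts μ]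
    (hμ : ∀ k : π.ker, μ.map (· * (k : G)) = μ) (hπ : IsOpenQuotientMap π)
    (hf : Continuous f) (hξ : Continuous ξ) (hξc : HasCompactSupport ξ) (x : G) :
    ‖conv μ f ξ x‖ₑ ≤ ‖conv (μ.map π) (fiberNorm π f) (fiberNorm π ξ) (π x)‖ₑ := by
  have hK : IsCompact (π.ker : Set G) := isCompact_iff_compactSpace.2 ‹_›
  set A : G → ℝ := fun y => √(fiberAverage π.ker (fun z => ‖f z‖ ^ 2) (x * y⁻¹)) *
    √(fiberAverage π.ker (fun z => ‖ξ z‖ ^ 2) y) with hA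
  have hA0 : 0 ≤ A := fun y => by positivity
  have hcf := continuous_fiberAverage (K := π.ker) (h := fun z => ‖f z‖ ^ 2) (by fun_prop)
  have hcξ := continuous_fiberAverage (K := π.ker) (h := fun z => ‖ξ z‖ ^ 2) (by fun_prop)
  have hAcont : Continuous A := by fun_prop
  have hAsupp : HasCompactSupport A := by
    refine HasCompactSupport.intro (hξc.isCompact.mul hK) fun g hg => ?_
    have : ∀ k : π.ker, ξ (g * k) = 0 := fun k => image_eq_zero_of_notMem_tsupport fun h' =>
      hg ⟨_, h', (k : G)⁻¹, inv_mem k.2, by simp⟩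
    simp [hA, fiberAverage, this]
  have hconv : conv (μ.map π) (fiberNorm π f) (fiberNorm π ξ) (π x) = ((∫ y, A y ∂μ : ℝ) : ℂ) := by
    rw [conv_map_comp hπ.continuous (continuous_fiberNorm hπ hf)
      (continuous_fiberNorm hπ hξ).aestronglyMeasurable, conv, ← integral_complex_ofReal]
    congr 1 with y
    rw [Function.comp_apply, Function.comp_apply, fiberNorm_apply hπ.surjective,
      fiberNorm_apply hπ.surjective, hA, Complex.ofReal_mul]
  set u : G → ℝ := fun y => ‖f (x * y⁻¹)‖ with hu
  have huc : Continuous u := by fun_prop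
  have hcs : HasCompactSupport fun y => u y * ‖ξ y‖ := hξc.norm.mul_left
  have hle : ∀ y, fiberAverage π.ker (fun y => u y * ‖ξ y‖) y ≤ A y := fun y => by
    refine (fiberAverage_mul_le huc hξ.norm (fun _ => norm_nonneg _) (fun _ => norm_nonneg _)
      y).trans_eq ?_
    rw [hA]
    congr 2
    -- Since `x * (y * k)⁻¹ = x * k⁻¹ * y⁻¹`, averaging in `y` matches averaging `f` over the coset
    -- of `x * y⁻¹`.
    rw [← fiberAverage_conj (by fun_prop)]
    simp [fiberAverage, hu, mul_assoc]
  have hmain : ‖conv μ f ξ x‖ ≤ ∫ y, A y ∂μ :=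
    calc ‖conv μ f ξ x‖ ≤ ∫ y, ‖f (x * y⁻¹) * ξ y‖ ∂μ := norm_integral_le_integral_norm _
      _ = ∫ y, fiberAverage π.ker (fun y => u y * ‖ξ y‖) y ∂μ := by
        rw [integral_fiberAverage hμ (by fun_prop) hcs]
        simp [hu]
      _ ≤ ∫ y, A y ∂μ := integral_mono_of_nonneg
        (ae_of_all _ (fiberAverage_nonneg fun y => by positivity))
        (hAcont.integrable_of_hasCompactSupport hAsupp) (ae_of_all _ hle)
  rw [hconv, ← ofReal_norm, ← ofReal_norm, Complex.norm_real,
    Real.norm_of_nonneg (integral_nonneg hA0)]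
  exact ENNReal.ofReal_le_ofReal hmain

end FiberNorm

/-! ### Dependence of (RD) on the measure and on the weight -/

section RDBound

variable {G : Type*} [Group G] [TopologicalSpace G] [MeasurableSpace G]

/-- Property (RD) formulated with respect to a given measure. -/
def HasRDFor (μ : Measure G) : Prop :=
  ∃ l : G → ℝ≥0, IsLengthFunction l ∧ LocallyBounded l ∧
    ∃ s c : ℝ, 0 < s ∧ 0 < c ∧
      ∀ f : G → ℂ, Continuous f → HasCompactSupport f →
        convNorm μ f ≤ ENNReal.ofReal c * weightedNorm μ l s f

/-- The convolution norm scales by `a` and the weighted norm by `a ^ (1/2)`, so the constant is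
multiplied by `a ^ (1/2)`. -/
theorem HasRDFor.smul_measure {μ : Measure G} (h : HasRDFor μ) {a : ℝ≥0∞} (ha : a ≠ 0)
    (ha' : a ≠ ∞) : HasRDFor (a • μ) := by
  obtain ⟨l, hl, hlb, s, c, hs, hc, hbd⟩ := h
  have hr : a ^ (1 / 2 : ℝ) ≠ ∞ := ENNReal.rpow_ne_top_of_nonneg (by norm_num) ha'
  have hr0 : a ^ (1 / 2 : ℝ) ≠ 0 := by simp [ha, ha']
  refine ⟨l, hl, hlb, s, (a ^ (1 / 2 : ℝ)).toReal * c, hs,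
    mul_pos (ENNReal.toReal_pos hr0 hr) hc, fun f hf hfc => ?_⟩
  rw [ENNReal.ofReal_mul ENNReal.toReal_nonneg, ENNReal.ofReal_toReal hr,
    weightedNorm_smul_measure]
  have hsq : a = a ^ (1 / 2 : ℝ) * a ^ (1 / 2 : ℝ) := by
    rw [← ENNReal.rpow_add _ _ ha ha']
    norm_num
  calc convNorm (a • μ) f ≤ a * (ENNReal.ofReal c * weightedNorm μ l s f) :=
        (convNorm_smul_measure_le f ha ha').trans (by gcongr; exact hbd f hf hfc)
    _ = a ^ (1 / 2 : ℝ) * a ^ (1 / 2 : ℝ) * (ENNReal.ofReal c * weightedNorm μ l s f) := by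
        rw [← hsq]
    _ = _ := by ring

theorem hasRDFor_smul_measure_iff {μ : Measure G} {a : ℝ≥0∞} (ha : a ≠ 0) (ha' : a ≠ ∞) :
    HasRDFor (a • μ) ↔ HasRDFor μ := by
  refine ⟨fun h => ?_, fun h => h.smul_measure ha ha'⟩
  have := h.smul_measure (ENNReal.inv_ne_zero.2 ha') (ENNReal.inv_ne_top.2 ha)
  rwa [smul_smul, ENNReal.inv_mul_cancel ha ha', one_smul] at this

theorem hasRD_iff_hasRDFor [IsTopologicalGroup G] [LocallyCompactSpace G] [BorelSpace G] :
    HasRD G ↔ HasRDFor (rightHaar G) := by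
  obtain rfl := BorelSpace.measurable_eq (α := G)
  rfl

end RDBound

section Density

theorem weightedNorm_le_of_le {G : Type*} [MeasurableSpace G] {μ : Measure G} {l l' : G → ℝ≥0} {M : ℝ≥0}
    (h : ∀ g, l g ≤ l' g + M) {s : ℝ} (hs : 0 < s) (f : G → ℂ) :
    weightedNorm μ l s f ≤ ((1 + M) ^ s : ℝ≥0) * weightedNorm μ l' s f := by
  have hsq : ((1 + M) ^ s : ℝ≥0) = ((((1 + M) ^ (2 * s) : ℝ≥0) : ℝ≥0∞)) ^ (1 / 2 : ℝ) := by
    rw [← ENNReal.coe_rpow_of_nonneg _ (by norm_num), ← NNReal.rpow_mul]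
    congr 2
    ring
  rw [weightedNorm, weightedNorm, hsq, ← ENNReal.mul_rpow_of_nonneg _ _ (by norm_num)]
  gcongr
  rw [← lintegral_const_mul' _ _ ENNReal.coe_ne_top]
  refine lintegral_mono fun x => ?_
  have hx : (1 + l x) ^ (2 * s) ≤ (1 + M) ^ (2 * s) * (1 + l' x) ^ (2 * s) := by
    rw [← NNReal.mul_rpow]
    gcongr
    calc 1 + l x ≤ 1 + (l' x + M) := by gcongr; exact h x
      _ ≤ 1 + (l' x + M) + M * l' x := le_self_add
      _ = (1 + M) * (1 + l' x) := by ring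
  calc ‖f x‖ₑ ^ 2 * (((1 + l x) ^ (2 * s) : ℝ≥0) : ℝ≥0∞)
      ≤ ‖f x‖ₑ ^ 2 * (((1 + M) ^ (2 * s) * (1 + l' x) ^ (2 * s) : ℝ≥0) : ℝ≥0∞) := by gcongr
    _ = _ := by push_cast; ring

theorem isFiniteMeasureOnCompacts_withDensity {G : Type*} [TopologicalSpace G] [R1Space G]
    [MeasurableSpace G] [BorelSpace G] {μ : Measure G}
    [IsFiniteMeasureOnCompacts μ] {l : G → ℝ≥0} (hb : LocallyBounded l) {s : ℝ} (hs : 0 < s) :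
    IsFiniteMeasureOnCompacts
      (μ.withDensity fun x => (((1 + l x) ^ (2 * s) : ℝ≥0) : ℝ≥0∞)) := by
  refine ⟨fun {C} hC => ?_⟩
  obtain ⟨B, hB⟩ := hb _ hC.closure
  -- Without the Hausdorff axiom a compact set may fail to be Borel; its closure is compact, Borel
  -- and of the same measure.
  rw [← hC.measure_closure, withDensity_apply _ isClosed_closure.measurableSet]
  refine (setLIntegral_mono' isClosed_closure.measurableSet (g := fun _ =>
    (((1 + B) ^ (2 * s) : ℝ≥0) : ℝ≥0∞)) fun x hx => ?_).trans_lt ?_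
  · have := hB (mem_image_of_mem l hx)
    gcongr
  · rw [setLIntegral_const]
    exact ENNReal.mul_lt_top ENNReal.coe_lt_top hC.closure.measure_lt_top

end Density

section Weight

variable {G : Type*} [Group G] [TopologicalSpace G] [MeasurableSpace G] [BorelSpace G]

theorem measurable_weight {l : G → ℝ≥0} (hl : IsLengthFunction l) (s : ℝ) :
    Measurable fun x => (((1 + l x) ^ (2 * s) : ℝ≥0) : ℝ≥0∞) := by
  have := hl.borel_measurable
  rw [← BorelSpace.measurable_eq (α := G)] at this
  fun_prop

theorem weightedNorm_eq_withDensity {l : G → ℝ≥0} (hl : IsLengthFunction l) (s : ℝ)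
    {f : G → ℂ} (hf : Continuous f) (μ : Measure G) :
    weightedNorm μ l s f = (∫⁻ x, ‖f x‖ₑ ^ 2
      ∂μ.withDensity fun x => (((1 + l x) ^ (2 * s) : ℝ≥0) : ℝ≥0∞)) ^ (1 / 2 : ℝ) := by
  rw [weightedNorm, lintegral_withDensity_eq_lintegral_mul _ (measurable_weight hl s)
    (by fun_prop : Continuous fun x => ‖f x‖ₑ ^ 2).measurable]
  simp [mul_comm]

theorem map_mul_right_withDensity [IsTopologicalGroup G] {μ : Measure G} [μ.IsMulRightInvariant]
    {w : G → ℝ≥0∞} (hw : Measurable w) {k : G} (hk : ∀ g, w (g * k) = w g) :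
    (μ.withDensity w).map (· * k) = μ.withDensity w := by
  ext A hA
  have hm : Measurable fun g : G => g * k := by fun_prop
  rw [Measure.map_apply hm hA, withDensity_apply _ (hm hA), withDensity_apply _ hA,
    ← (⟨hm, map_mul_right_eq_self μ k⟩ : MeasurePreserving _ μ μ).setLIntegral_comp_preimage hA hw]
  simp only [hk]

end Weight

/-! ### Transfer of (RD) in both directions -/

section Comap

variable {G Q : Type*} [Group G] [TopologicalSpace G] [MeasurableSpace G] [BorelSpace G]
  [Group Q] [TopologicalSpace Q] [MeasurableSpace Q] [BorelSpace Q] {π : G →* Q} {μ : Measure G}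

theorem weightedNorm_comp {l : Q → ℝ≥0} (hl : IsLengthFunction l) (hπ : Continuous π) (s : ℝ)
    {f : Q → ℂ} (hf : Continuous f) :
    weightedNorm (μ.map π) l s f = weightedNorm μ (l ∘ π) s (f ∘ π) := by
  have hm : Measurable fun x => ‖f x‖ₑ ^ 2 * (((1 + l x) ^ (2 * s) : ℝ≥0) : ℝ≥0∞) :=
    (by fun_prop : Continuous fun x => ‖f x‖ₑ ^ 2).measurable.mul (measurable_weight hl s)
  rw [weightedNorm, lintegral_map hm hπ.measurable]
  rfl

theorem convNorm_map_le [IsTopologicalGroup Q] (hπ : Continuous π) {f : Q → ℂ} (hf : Continuous f) :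
    convNorm (μ.map π) f ≤ convNorm μ (f ∘ π) := by
  refine iSup₂_le fun ξ hξ => iSup_le fun h1 => ?_
  have hm : AEMeasurable π μ := hπ.measurable.aemeasurable
  have hξ' : MemLp (ξ ∘ π) 2 μ := (memLp_map_measure_iff hξ.1 hm).1 hξ
  rw [eLpNorm_map_measure hξ.1 hm] at h1
  have hle : eLpNorm (conv (μ.map π) f ξ) 2 (μ.map π) ≤ eLpNorm (conv μ (f ∘ π) (ξ ∘ π)) 2 μ := by
    rw [eLpNorm_eq_lintegral_rpow_enorm_toReal two_ne_zero ENNReal.ofNat_ne_top,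
      eLpNorm_eq_lintegral_rpow_enorm_toReal two_ne_zero ENNReal.ofNat_ne_top]
    gcongr
    -- Only this inequality is needed, and it requires no measurability of the convolution, which is
    -- not known for general `ξ` in `L²`.
    refine (lintegral_map_le _ _).trans_eq ?_
    simp only [conv_map_comp hπ hf hξ.1]
  refine hle.trans ?_
  exact le_iSup₂_of_le _ hξ' (le_iSup_of_le h1 le_rfl)

end Comap

section Main

variable {G Q : Type*} [Group G] [TopologicalSpace G] [IsTopologicalGroup G]
  [LocallyCompactSpace G] [Group Q] [TopologicalSpace Q] [IsTopologicalGroup Q]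
  {π : G →* Q}

section Measure

variable [MeasurableSpace G] [BorelSpace G] [MeasurableSpace Q] [BorelSpace Q] {μ : Measure G}

theorem HasRDFor.map (hπ : IsOpenQuotientMap π) (hK : IsCompact (π.ker : Set G))
    (h : HasRDFor μ) : HasRDFor (μ.map π) := by
  obtain ⟨l, hl, hlb, s, c, hs, hc, hbd⟩ := h
  obtain ⟨l', hl', hlb', M, hM⟩ := exists_isLengthFunction_quotient hπ hK hl hlb
  refine ⟨l', hl', hlb', s, c * ((1 + M) ^ s : ℝ≥0), hs, by positivity, fun f hf hfc => ?_⟩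
  have hfπ : HasCompactSupport (f ∘ π) := by
    refine HasCompactSupport.intro'
      ((isProperMap_of_isCompact_ker hπ hK).isCompact_preimage hfc.isCompact)
      ((isClosed_tsupport f).preimage hπ.continuous) fun g hg => ?_
    exact image_eq_zero_of_notMem_tsupport (f := f) hg
  calc convNorm (μ.map π) f ≤ convNorm μ (f ∘ π) := convNorm_map_le hπ.continuous hf
    _ ≤ ENNReal.ofReal c * weightedNorm μ l s (f ∘ π) := hbd _ (hf.comp hπ.continuous) hfπ
    _ ≤ ENNReal.ofReal c * (((1 + M) ^ s : ℝ≥0) * weightedNorm μ (l' ∘ π) s (f ∘ π)) := by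
        gcongr
        exact weightedNorm_le_of_le hM hs _
    _ = _ := by
        rw [weightedNorm_comp hl' hπ.continuous s hf, ENNReal.ofReal_mul hc.le,
          ENNReal.ofReal_coe_nnreal, mul_assoc]

theorem hasRDFor_of_map [μ.Regular] [μ.IsMulRightInvariant] (hπ : IsOpenQuotientMap π)
    (hK : IsCompact (π.ker : Set G)) (h : HasRDFor (μ.map π)) : HasRDFor μ := by
  have : CompactSpace π.ker := isCompact_iff_compactSpace.1 hK
  have : (μ.map π).Regular := regular_map_of_isProperMap (isProperMap_of_isCompact_ker hπ hK) μ
  have hμ : ∀ k : π.ker, μ.map (· * (k : G)) = μ := fun k => map_mul_right_eq_self μ _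
  have hm : AEMeasurable π μ := hπ.continuous.measurable.aemeasurable
  obtain ⟨l, hl, hlb, s, c, hs, hc, hbd⟩ := h
  have hl' := hl.comp hπ.continuous
  have hlb' := hlb.comp hπ.continuous
  refine ⟨l ∘ π, hl', hlb', s, c, hs, hc, fun f hf hfc => ?_⟩
  have hF := continuous_fiberNorm hπ hf
  have hFc := hasCompactSupport_fiberNorm hπ hfc
  have hweight : weightedNorm (μ.map π) l s (fiberNorm π f) = weightedNorm μ (l ∘ π) s f := by
    -- The weight is absorbed into the measure: `l ∘ π` is constant on cosets, so the weighted
    -- measure is still invariant under the kernel and the identity for fiber norms applies to it.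
    have := isFiniteMeasureOnCompacts_withDensity (μ := μ) hlb' hs
    rw [weightedNorm_comp hl hπ.continuous s hF, weightedNorm_eq_withDensity hl' s hf,
      weightedNorm_eq_withDensity hl' s (hF.comp hπ.continuous)]
    congr 1
    refine lintegral_enorm_fiberNorm (fun k => ?_) hπ hf hfc
    exact map_mul_right_withDensity (measurable_weight hl' s) fun g => by
      simp [MonoidHom.mem_ker.1 k.2]
  refine convNorm_le_of_forall_hasCompactSupport hf hfc fun ξ hξ hξc => ?_
  have hX := continuous_fiberNorm hπ hξ
  have hXc := hasCompactSupport_fiberNorm hπ hξc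
  have hXnorm : eLpNorm (fiberNorm π ξ) 2 (μ.map π) = eLpNorm ξ 2 μ := by
    rw [eLpNorm_map_measure hX.aestronglyMeasurable hm,
      eLpNorm_eq_lintegral_rpow_enorm_toReal two_ne_zero ENNReal.ofNat_ne_top,
      eLpNorm_eq_lintegral_rpow_enorm_toReal two_ne_zero ENNReal.ofNat_ne_top]
    simpa using congrArg (· ^ (2⁻¹ : ℝ)) (lintegral_enorm_fiberNorm hμ hπ hξ hξc)
  calc eLpNorm (conv μ f ξ) 2 μ
      ≤ eLpNorm (conv (μ.map π) (fiberNorm π f) (fiberNorm π ξ) ∘ π) 2 μ :=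
        eLpNorm_mono_enorm fun x => enorm_conv_le_enorm_conv_fiberNorm hμ hπ hf hξ hξc x
    _ = eLpNorm (conv (μ.map π) (fiberNorm π f) (fiberNorm π ξ)) 2 (μ.map π) :=
        (eLpNorm_map_measure (continuous_conv hF hX hXc).aestronglyMeasurable hm).symm
    _ ≤ convNorm (μ.map π) (fiberNorm π f) * eLpNorm (fiberNorm π ξ) 2 (μ.map π) :=
        eLpNorm_conv_le _ (hX.memLp_of_hasCompactSupport hXc)
    _ ≤ ENNReal.ofReal c * weightedNorm μ (l ∘ π) s f * eLpNorm ξ 2 μ := by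
        rw [hXnorm, ← hweight]
        gcongr
        exact hbd _ hF hFc

end Measure

/-- Property (RD) is invariant under quotients by compact kernels. -/
theorem hasRD_iff_of_isCompact_ker [LocallyCompactSpace Q] (hπ : IsOpenQuotientMap π)
    (hK : IsCompact (π.ker : Set G)) : HasRD G ↔ HasRD Q := by
  let _ : MeasurableSpace G := borel G
  have : BorelSpace G := ⟨rfl⟩
  let _ : MeasurableSpace Q := borel Q
  have : BorelSpace Q := ⟨rfl⟩
  obtain ⟨a, ha, ha', hmap⟩ := exists_map_rightHaar_eq_smul hπ hK
  rw [hasRD_iff_hasRDFor, hasRD_iff_hasRDFor, ← hasRDFor_smul_measure_iff (μ := rightHaar Q) ha ha', ← hmap]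
  exact ⟨HasRDFor.map hπ hK, hasRDFor_of_map hπ hK⟩

end Main

end RapidDecay

theorem mainTheorem10 {G : Type*} [Group G] [TopologicalSpace G] [IsTopologicalGroup G]
    [LocallyCompactSpace G] [T2Space G] (K : Subgroup G) [K.Normal]
    (hK : IsCompact (K : Set G)) :
    RapidDecay.HasRD G ↔ RapidDecay.HasRD (G ⧸ K) :=
  RapidDecay.hasRD_iff_of_isCompact_ker (π := QuotientGroup.mk' K)
    QuotientGroup.isOpenQuotientMap_mk (by rwa [QuotientGroup.ker_mk'])
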